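/- Let $n\in\mathbb{N}$ and let $\mu=n$ or $\mu=-n$. Let $S_{-1},S_0,S_1,\dots$ be the rational functions of the complex variable $z$ given by $S_{-1}=S_0=1$ and the recurrence relation $$S_{k+1}S_{k-1}=-z\left[S_k\frac{d^2S_k}{dz^2}-\left(\frac{dS_k}{dz}\right)^2\right]-S_k\frac{dS_k}{dz}+(z+\mu)S_k^2,\qquad k\ge 0.$$ Then: (a) for $k=0,1,\dots,n$, all zeros (in $\mathbb{C}$) of the rational function $S_k$ are simple; (b) for $k=0,1,\dots,n$, $S_k$ is a monic polynomial in $z$ of degree $\tfrac12k(k+1)$. (In particular $S_{k-1}\neq 0$ whenever $0\le k\le n$, so that $S_0,\dots,S_n$ are uniquely determined by dividing by $S_{k-1}$ in the recurrence.) -/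

import Mathlib

open Polynomial

noncomputable section

/-- The derivative `d/dz` of a rational function over `ℂ`, by the quotient rule applied to its
reduced representation `num / denom`. -/
def ratDeriv (f : RatFunc ℂ) : RatFunc ℂ :=
  algebraMap ℂ[X] (RatFunc ℂ)
      (derivative f.num * f.denom - f.num * derivative f.denom) /
    algebraMap ℂ[X] (RatFunc ℂ) (f.denom ^ 2)

/-- Two representations of a fraction have the same quotient-rule derivative. -/
theorem quotientRule_aux {R : Type*} [CommRing R] (a b p q a' b' p' q' : R)
    (e : a * q = p * b) (e' : a' * q + a * q' = p' * b + p * b') :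
    (a' * b - a * b') * q ^ 2 = (p' * q - p * q') * b ^ 2 := by
  linear_combination (b * q) * e' - (q * b' + b * q') * e

/-- The quotient rule holds for every representation `p / q` of a rational function. -/
theorem ratDeriv_div (p q : ℂ[X]) (hq : q ≠ 0) :
    ratDeriv (algebraMap ℂ[X] (RatFunc ℂ) p / algebraMap ℂ[X] (RatFunc ℂ) q) =
      algebraMap ℂ[X] (RatFunc ℂ) (derivative p * q - p * derivative q) /
        algebraMap ℂ[X] (RatFunc ℂ) (q ^ 2) := by
  have hinj := RatFunc.algebraMap_injective ℂ
  have key : ∀ f : RatFunc ℂ, f.num * q = p * f.denom →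
      ratDeriv f = algebraMap ℂ[X] (RatFunc ℂ) (derivative p * q - p * derivative q) /
        algebraMap ℂ[X] (RatFunc ℂ) (q ^ 2) := by
    intro f e
    have hd : f.denom ≠ 0 := RatFunc.denom_ne_zero f
    have e' := congrArg derivative e
    rw [derivative_mul, derivative_mul] at e'
    unfold ratDeriv
    rw [div_eq_div_iff ((map_ne_zero_iff _ hinj).mpr (pow_ne_zero 2 hd))
      ((map_ne_zero_iff _ hinj).mpr (pow_ne_zero 2 hq)), ← map_mul, ← map_mul]
    exact congrArg _ (quotientRule_aux _ _ _ _ _ _ _ _ e e')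
  exact key _ ((RatFunc.num_mul_eq_mul_denom_iff hq).mpr rfl)

/-- On polynomials `ratDeriv` is the usual derivative. -/
theorem ratDeriv_algebraMap (p : ℂ[X]) :
    ratDeriv (algebraMap ℂ[X] (RatFunc ℂ) p) =
      algebraMap ℂ[X] (RatFunc ℂ) (derivative p) := by
  simpa using ratDeriv_div p 1 one_ne_zero

/-- The right-hand side `-z (f f'' - (f')²) - f f' + (z + μ) f²` of the recurrence relation,
for a rational function `f` of `z`. -/
def umemuraRHS (μ : ℂ) (f : RatFunc ℂ) : RatFunc ℂ :=
  -RatFunc.X * (f * ratDeriv (ratDeriv f) - ratDeriv f ^ 2) - f * ratDeriv f +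
    (RatFunc.X + RatFunc.C μ) * f ^ 2

/-- The sequence `S_{-1}, S_0, S_1, …` (index shifted by one) of rational functions with
`S_{-1} = S_0 = 1` and
`S_{m+1} S_{m-1} = -z (S_m S_m'' - (S_m')²) - S_m S_m' + (z + μ) S_m²`. -/
def umemuraShift (μ : ℂ) : ℕ → RatFunc ℂ
  | 0 => 1
  | 1 => 1
  | k + 2 => umemuraRHS μ (umemuraShift μ (k + 1)) / umemuraShift μ k

/-- The rational function `S_k(z; μ)`, `k = 0, 1, 2, …`. -/
def umemuraS (μ : ℂ) (k : ℕ) : RatFunc ℂ := umemuraShift μ (k + 1)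

/-- The recurrence in product form; the divisor is `S_{k-1}`. -/
theorem umemuraS_succ_mul (μ : ℂ) (k : ℕ) (h : umemuraShift μ k ≠ 0) :
    umemuraS μ (k + 1) * umemuraShift μ k = umemuraRHS μ (umemuraS μ k) := by
  simp only [umemuraS, umemuraShift]
  exact div_mul_cancel₀ _ h

end

/-! For consecutive terms a, b, c = S_{k-1}, S_k, S_{k+1}, two laws propagate along with the
recurrence: the Wronskian law c'a - ca' = (2k+1)b² and the bilinear equation ab'' - 2a'b' + a''b =
0. The first makes the next division exact; the second makes zeros simple once neighbours are
coprime. A common zero of b and c could only lie at z = 0, and `value` excludes it while μ² ≠ k²,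
hence up to index n for μ = ±n. -/

/-- The right-hand side of the recurrence relation, for a polynomial. -/
noncomputable def umemuraPoly (μ : ℂ) (f : ℂ[X]) : ℂ[X] :=
  -X * (f * derivative (derivative f) - derivative f ^ 2) - f * derivative f +
    (X + C μ) * f ^ 2

theorem umemuraRHS_algebraMap (μ : ℂ) (f : ℂ[X]) :
    umemuraRHS μ (algebraMap ℂ[X] (RatFunc ℂ) f) =
      algebraMap ℂ[X] (RatFunc ℂ) (umemuraPoly μ f) := by
  simp [umemuraRHS, umemuraPoly, ratDeriv_algebraMap]

theorem derivative_umemuraPoly (μ : ℂ) (f : ℂ[X]) :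
    derivative (umemuraPoly μ f) =
      -(2 * f * derivative (derivative f)) -
        X * (f * derivative (derivative (derivative f)) -
          derivative f * derivative (derivative f)) + f ^ 2 +
        2 * (X + C μ) * f * derivative f := by
  simp only [umemuraPoly, derivative_add, derivative_sub, derivative_mul, derivative_neg,
    derivative_X, derivative_C, sq]
  ring

theorem monic_umemuraPoly (μ : ℂ) {f : ℂ[X]} (hf : f.Monic) :
    (umemuraPoly μ f).Monic ∧ (umemuraPoly μ f).natDegree = 2 * f.natDegree + 1 := by
  have hm : ((X + C μ) * f ^ 2).Monic := (monic_X_add_C μ).mul (hf.pow 2)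
  have hd : ((X + C μ) * f ^ 2).natDegree = 2 * f.natDegree + 1 := by
    rw [(monic_X_add_C μ).natDegree_mul (hf.pow 2), natDegree_X_add_C, hf.natDegree_pow]
    ring
  have hlow : (-X * (f * derivative (derivative f) - derivative f ^ 2) -
      f * derivative f).natDegree ≤ 2 * f.natDegree := by
    have h3 := natDegree_derivative_le f
    have h2 : (derivative (derivative f)).natDegree ≤ f.natDegree - 2 :=
      (natDegree_derivative_le _).trans (by omega)
    rcases Nat.eq_zero_or_pos f.natDegree with h0 | h0
    · have : derivative f = 0 := by
        rw [eq_C_of_natDegree_eq_zero h0, derivative_C]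
      simp [this]
    have t1 : (f * derivative (derivative f)).natDegree ≤ 2 * f.natDegree - 1 :=
      natDegree_mul_le.trans (by omega)
    have t2 : (derivative f ^ 2).natDegree ≤ 2 * f.natDegree - 1 :=
      (natDegree_pow_le_of_le 2 h3).trans (by omega)
    have t3 : (f * derivative f).natDegree ≤ 2 * f.natDegree :=
      natDegree_mul_le.trans (by omega)
    have t4 := natDegree_sub_le_of_le t1 t2
    have t5 : (-X * (f * derivative (derivative f) - derivative f ^ 2)).natDegree ≤
        2 * f.natDegree := by
      refine natDegree_mul_le.trans ?_
      rw [natDegree_neg, natDegree_X]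
      omega
    exact (natDegree_sub_le_of_le t5 t3).trans (by omega)
  have hlt : (-X * (f * derivative (derivative f) - derivative f ^ 2) -
      f * derivative f).degree < ((X + C μ) * f ^ 2).degree := by
    refine degree_lt_degree ?_
    omega
  refine ⟨hm.add_of_right hlt, ?_⟩
  rw [umemuraPoly, natDegree_add_eq_right_of_degree_lt hlt, hd]

/-- The properties of three consecutive members `a, b, c = S_{k-1}, S_k, S_{k+1}` of the sequence
that are carried through the induction on `k`. -/
structure UmemuraTriple (μ : ℂ) (k : ℕ) (a b c : ℂ[X]) : Prop where
  monic_left : a.Monic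
  monic_mid : b.Monic
  -- This is deg a = k(k-1)/2, free of truncated subtraction.
  degree_left : 2 * a.natDegree + k = k * k
  degree_mid : 2 * b.natDegree = k * (k + 1)
  eval_zero : b.eval 0 ≠ 0
  simple : ∀ t, b.eval t = 0 → (derivative b).eval t ≠ 0
  coprime : IsCoprime a b
  dvd : b ∣ umemuraPoly μ a
  recurrence : c * a = umemuraPoly μ b
  wronskian : derivative c * a - c * derivative a = (2 * (k : ℂ[X]) + 1) * b ^ 2
  hirota : a * derivative (derivative b) - 2 * derivative a * derivative b +
    derivative (derivative a) * b = 0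
  value : c.eval 0 * (μ * a.eval 0 - (derivative a).eval 0) = (μ ^ 2 - k ^ 2) * b.eval 0 ^ 2

theorem UmemuraTriple.base (μ : ℂ) : UmemuraTriple μ 0 1 1 (X + C μ) where
  monic_left := monic_one
  monic_mid := monic_one
  degree_left := by simp
  degree_mid := by simp
  eval_zero := by simp
  simple := by simp
  coprime := isCoprime_one_left
  dvd := one_dvd _
  recurrence := by simp [umemuraPoly]
  wronskian := by simp
  hirota := by simp
  value := by simp [sq]

/-- A solution `c` of `b c'' - 2 b' c' + b'' c = 0` has only simple roots away from the
roots of `b`. -/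
theorem simple_root_of_hirota {b c : ℂ[X]} (hc : c ≠ 0)
    (h : b * derivative (derivative c) - 2 * derivative b * derivative c +
      derivative (derivative b) * c = 0) {t : ℂ} (hb : b.eval t ≠ 0) (ht : c.eval t = 0) :
    (derivative c).eval t ≠ 0 := by
  intro ht'
  -- At a zero of order m ≥ 2, c'' has order m - 2, while `h` and b(t) ≠ 0 force order at least m -
  -- 1.
  have hm1 : (derivative c).rootMultiplicity t = c.rootMultiplicity t - 1 :=
    derivative_rootMultiplicity_of_root ht
  have hm2 : (derivative (derivative c)).rootMultiplicity t =
      (derivative c).rootMultiplicity t - 1 :=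
    derivative_rootMultiplicity_of_root ht'
  have hdc : derivative c ≠ 0 := by
    intro h0
    rw [eq_C_of_derivative_eq_zero h0, eval_C] at ht
    exact hc (by rw [eq_C_of_derivative_eq_zero h0, ht, C_0])
  have hddc : derivative (derivative c) ≠ 0 := by
    intro h0
    rw [eq_C_of_derivative_eq_zero h0, eval_C] at ht'
    exact hdc (by rw [eq_C_of_derivative_eq_zero h0, ht', C_0])
  have hpos : 0 < (derivative c).rootMultiplicity t := (rootMultiplicity_pos hdc).mpr ht'
  have d1 : (X - C t) ^ (derivative c).rootMultiplicity t ∣ derivative c :=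
    pow_rootMultiplicity_dvd _ _
  have d0 : (X - C t) ^ (derivative c).rootMultiplicity t ∣ c :=
    (pow_dvd_pow _ (by omega)).trans (pow_rootMultiplicity_dvd c t)
  have d2 : (X - C t) ^ (derivative c).rootMultiplicity t ∣ b * derivative (derivative c) := by
    have e : b * derivative (derivative c) =
        2 * derivative b * derivative c - derivative (derivative b) * c := by
      linear_combination h
    rw [e]
    exact dvd_sub (d1.mul_left _) (d0.mul_left _)
  have hcop : IsCoprime ((X - C t) ^ (derivative c).rootMultiplicity t) b := by
    refine IsCoprime.pow_left (((irreducible_X_sub_C t).coprime_iff_not_dvd).mpr ?_)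
    rw [dvd_iff_isRoot]
    exact hb
  have := (le_rootMultiplicity_iff hddc).mpr (hcop.dvd_of_dvd_mul_left d2)
  omega

theorem UmemuraTriple.step {μ : ℂ} {k : ℕ} {a b c : ℂ[X]} (h : UmemuraTriple μ k a b c)
    (hμ : μ ^ 2 ≠ (k : ℂ) ^ 2) : ∃ e, UmemuraTriple μ (k + 1) b c e := by
  have ha := h.monic_left.ne_zero
  have hb := h.monic_mid.ne_zero
  obtain ⟨hRm, hRd⟩ := monic_umemuraPoly μ h.monic_mid
  have hcm : c.Monic := by
    refine h.monic_left.of_mul_monic_right ?_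
    rw [h.recurrence]
    exact hRm
  have hcd : c.natDegree + a.natDegree = 2 * b.natDegree + 1 := by
    rw [← hcm.natDegree_mul h.monic_left, h.recurrence, hRd]
  have hc0 : c.eval 0 ≠ 0 := by
    intro h0
    have := h.value
    rw [h0, zero_mul] at this
    exact mul_ne_zero (sub_ne_zero.mpr hμ) (pow_ne_zero 2 h.eval_zero) this.symm
  have hcop : IsCoprime b c := by
    rw [isCoprime_iff_aeval_ne_zero_of_isAlgClosed ℂ ℂ]
    intro t
    simp only [coe_aeval_eq_eval]
    by_contra! hbc
    have e := congrArg (eval t) h.recurrence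
    simp only [umemuraPoly, eval_mul, eval_add, eval_sub, eval_pow, eval_neg, eval_X, eval_C,
      hbc.1, hbc.2] at e
    -- At a common zero only the term X(b')² of the recurrence survives.
    have e' : t * (derivative b).eval t ^ 2 = 0 := by linear_combination -e
    rcases mul_eq_zero.mp e' with h0 | h0
    · exact h.eval_zero (h0 ▸ hbc.1)
    · exact h.simple t hbc.1 (pow_eq_zero_iff two_ne_zero |>.mp h0)
  have hw' : derivative (derivative c) * a - c * derivative (derivative a) =
      2 * (2 * (k : ℂ[X]) + 1) * b * derivative b := by
    have := congrArg derivative h.wronskian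
    simp only [derivative_sub, derivative_mul, derivative_add, derivative_natCast, sq,
      derivative_one, derivative_ofNat] at this
    linear_combination this
  have hH : b * derivative (derivative c) - 2 * derivative b * derivative c +
      derivative (derivative b) * c = 0 := by
    refine (mul_eq_zero.mp ?_).resolve_left ha
    linear_combination b * hw' - 2 * derivative b * h.wronskian + c * h.hirota
  have hdvd : b ∣ umemuraPoly μ c := by
    -- Write R for `umemuraPoly μ`. Modulo b, c'a ≡ ca' and c''a ≡ ca'', so a²R(c) ≡ c²R(a) ≡ 0, and
    -- a is a unit.
    refine (h.coprime.symm.pow_right (n := 2)).dvd_of_dvd_mul_left ?_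
    obtain ⟨q, hq⟩ := h.dvd
    refine ⟨c ^ 2 * q - X * (a * c * (2 * (2 * (k : ℂ[X]) + 1) * derivative b) -
      (2 * (k : ℂ[X]) + 1) * b * (derivative a * c + a * derivative c)) -
      a * c * ((2 * (k : ℂ[X]) + 1) * b), ?_⟩
    simp only [umemuraPoly] at hq ⊢
    linear_combination c ^ 2 * hq - X * a * c * hw' +
      (X * (derivative a * c + a * derivative c) - a * c) * h.wronskian
  obtain ⟨e, he⟩ := hdvd
  have hrec : e * b = umemuraPoly μ c := by rw [he, mul_comm]
  have hR' := derivative_umemuraPoly μ b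
  rw [← h.recurrence, derivative_mul] at hR'
  have hE' := derivative_umemuraPoly μ c
  rw [← hrec, derivative_mul] at hE'
  have hR := h.recurrence
  have hE := hrec
  simp only [umemuraPoly] at hR hE
  have hH' : derivative b * derivative (derivative c) + b * derivative (derivative (derivative c))
      - 2 * derivative (derivative b) * derivative c
      - 2 * derivative b * derivative (derivative c)
      + derivative (derivative (derivative b)) * c
      + derivative (derivative b) * derivative c = 0 := by
    have := congrArg derivative hH
    simp only [derivative_sub, derivative_mul, derivative_add, derivative_ofNat,
      derivative_zero] at this
    linear_combination this
  have hW : derivative e * b - e * derivative b = (2 * ((k + 1 : ℕ) : ℂ[X]) + 1) * c ^ 2 := by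
    -- Since c(c'a - ca') = 2c'(ca) - c(ca)', inserting ca = R(b) eliminates a; by `hH` a factor b
    -- then cancels.
    have hT : (2 * (k : ℂ[X]) + 1) * b * c =
        -2 * X * derivative c * derivative (derivative b) - 2 * derivative b * derivative c +
        2 * (X + C μ) * (b * derivative c - derivative b * c) +
        2 * c * derivative (derivative b) + X * c * derivative (derivative (derivative b)) -
        c * b + X * derivative b * derivative (derivative c) := by
      refine mul_left_cancel₀ hb ?_
      linear_combination -c * h.wronskian + 2 * derivative c * hR - c * hR' -
        X * derivative b * hH
    -- Likewise b(e'b - eb') = b(eb)' - 2b'(eb), with eb = R(c).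
    refine mul_left_cancel₀ hb ?_
    push_cast
    linear_combination b * hE' - 2 * derivative b * hE + (X * derivative c - 2 * c) * hH -
      X * c * hH' - c * hT
  refine ⟨e, h.monic_mid, hcm, ?_, ?_, hc0, ?_, hcop, ⟨a, by rw [← h.recurrence]⟩, hrec, hW, hH, ?_⟩
  · have := h.degree_mid
    linarith
  · have h1 := h.degree_left
    have h2 := h.degree_mid
    nlinarith
  · intro t ht
    refine simple_root_of_hirota hcm.ne_zero hH ?_ ht
    intro hbt
    obtain ⟨u, v, huv⟩ := hcop
    have := congrArg (eval t) huv
    simp [hbt, ht] at this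
  · have e1 := congrArg (eval 0) hE
    have e2 := congrArg (eval 0) hR
    have e3 := congrArg (eval 0) h.wronskian
    simp only [eval_mul, eval_add, eval_sub, eval_pow, eval_neg, eval_X, eval_C, eval_natCast,
      eval_ofNat, eval_one] at e1 e2 e3
    -- At 0 both recurrences lose their X terms; the Wronskian law turns k² into k² + (2k+1) =
    -- (k+1)².
    refine mul_right_cancel₀ (pow_ne_zero 2 h.eval_zero) ?_
    push_cast
    linear_combination (μ * b.eval 0 - (derivative b).eval 0) * b.eval 0 * e1 -
      c.eval 0 * (μ * c.eval 0 - (derivative c).eval 0) * e2 - c.eval 0 ^ 2 * e3 +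
      c.eval 0 ^ 2 * h.value

theorem exists_umemuraTriple (μ : ℂ) (n : ℕ) (hμ : ∀ j < n, μ ^ 2 ≠ (j : ℂ) ^ 2) :
    ∀ k ≤ n, ∃ a b c, UmemuraTriple μ k a b c ∧
      umemuraShift μ k = algebraMap ℂ[X] (RatFunc ℂ) a ∧
      umemuraShift μ (k + 1) = algebraMap ℂ[X] (RatFunc ℂ) b := by
  intro k
  induction k with
  | zero => exact fun _ => ⟨1, 1, _, UmemuraTriple.base μ, by simp [umemuraShift],
      by simp [umemuraShift]⟩
  | succ k ih =>
    intro hk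
    obtain ⟨a, b, c, h, h1, h2⟩ := ih (by omega)
    obtain ⟨e, he⟩ := h.step (hμ k (by omega))
    refine ⟨b, c, e, he, h2, ?_⟩
    have ha : algebraMap ℂ[X] (RatFunc ℂ) a ≠ 0 :=
      (map_ne_zero_iff _ (RatFunc.algebraMap_injective ℂ)).mpr h.monic_left.ne_zero
    rw [umemuraShift, h1, h2, umemuraRHS_algebraMap, div_eq_iff ha, ← map_mul, h.recurrence]

theorem theorem4p3 (n : ℕ) (μ : ℂ) (hμ : μ = (n : ℂ) ∨ μ = -(n : ℂ)) :
    (∀ k : ℕ, k ≤ n → ∀ z₀ : ℂ, (umemuraS μ k).num.IsRoot z₀ →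
      (umemuraS μ k).num.rootMultiplicity z₀ = 1) ∧
    (∀ k : ℕ, k ≤ n → ∃ P : Polynomial ℂ, P.Monic ∧ P.natDegree = k * (k + 1) / 2 ∧
      umemuraS μ k = algebraMap (Polynomial ℂ) (RatFunc ℂ) P) := by
  have hne : ∀ j < n, μ ^ 2 ≠ (j : ℂ) ^ 2 := by
    intro j hj hjn
    have e : (n : ℂ) ^ 2 = (j : ℂ) ^ 2 := by
      rcases hμ with rfl | rfl
      · exact hjn
      · rwa [neg_sq] at hjn
    have e' : n ^ 2 = j ^ 2 := by exact_mod_cast e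
    exact hj.ne' (Nat.pow_left_injective two_ne_zero e')
  constructor
  · intro k hk z₀ hz
    obtain ⟨a, b, c, h, -, hb⟩ := exists_umemuraTriple μ n hne k hk
    rw [umemuraS, hb, RatFunc.num_algebraMap] at hz ⊢
    have hd := h.simple z₀ hz
    have hm := derivative_rootMultiplicity_of_root hz
    rw [rootMultiplicity_eq_zero hd] at hm
    have := (rootMultiplicity_pos h.monic_mid.ne_zero).mpr hz
    omega
  · intro k hk
    obtain ⟨a, b, c, h, -, hb⟩ := exists_umemuraTriple μ n hne k hk
    exact ⟨b, h.monic_mid, by have := h.degree_mid; omega, hb⟩
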